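/- Let $\mathrm{Cl}(n)$ be the real Clifford algebra of $\mathbb R^n$ with $v^2=\|v\|^2$. For vectors put $u\wedge v=uv-\langle u,v\rangle$; let $\mathrm{Cl}^2(n)$ be the span of all $u\wedge v$ (the bivectors), with inner product $\langle x,y\rangle=\langle x^\dagger y\rangle_0$ (scalar part, $\dagger$ = reversion) and its norm. For $b\in\mathrm{Cl}^2(n)$ and $v\in\mathbb R^n$ let $b\llcorner v\in\mathbb R^n$ be the right contraction; it is bilinear and $(u\wedge w)\llcorner v=\langle w,v\rangle u-\langle u,v\rangle w$. A bivector is simple if it has the form $u\wedge v$. A simple projection of $b$ is a simple bivector $s$ minimizing $\|b-s\|$ over all simple bivectors. Algorithm. Input $b\in \mathrm{Cl}^2(n)$, $v\in\mathbb R^n$, $\varepsilon\in\mathbb R$. Set $v_{\rm prev}\leftarrow v$. While $\|v+v_{\rm prev}\|>\varepsilon$: set $v_{\rm prev}\leftarrow v$, then $v\leftarrow b\llcorner(b\llcorner v)$, then $v\leftarrow v/\|v\|$. After the loop put $\sigma u=b\llcorner v$ and return $(\sigma u\wedge v,\;v)$. Write $v^{(t)}$ for the value of $v$ after $t$ passes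 of the loop body (regardless of the test). Theorem. Let $b\in\mathrm{Cl}^2(n)$. (1) Let $B_{ij}=\langle e_i\wedge e_j,b\rangle$. Then $B$ is skew-symmetric, $b=\sum_{i<j}B_{ij}\,e_i\wedge e_j$, and $b\llcorner v=Bv$, $b\llcorner(b\llcorner v)=B^2v$ for all $v\in\mathbb R^n$. Now let $b\neq0$, let $\sigma_1$ be the largest singular value of $v\mapsto b\llcorner v$, let $E=\ker(B^2+\sigma_1^2 I)$ be the dominant eigenspace of $B^2$ (the dominant plane, when $\dim E=2$), and let $v\in\mathbb R^n$ have non-zero orthogonal projection onto $E$. Then: (2) $b\llcorner(b\llcorner v^{(t)})\ne0$ for all $t$, so the algorithm never divides by zero, and the loop terminates for every $\varepsilon>0$. (3) $\sigma_1>0$, and there are orthonormal $u_1,v_1\in E$ with $b\llcorner v_1=\sigma_1u_1$ and $b\llcorner u_1=-\sigma_1v_1$ such that: (a) $\sigma_1(u_1\wedge v_1)$ is a simple projection of $b$, and its matrix is a best approximation of $B$ in the Frobenius norm among all real $n\times n$ matrices of rank at most $2$; if $\dim E=2$, it is the only simple projection of $b$; (b) $(-1)^t v^{(t)}\to v_1$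 as $t\to\infty$; (c) for every $\delta>0$ there is $\varepsilon_0>0$ such that for every $0<\varepsilon\le\varepsilon_0$ the algorithm returns a pair $(\sigma(u\wedge w),w)$ with $\sigma>0$, $u,w$ orthonormal, $b\llcorner w=\sigma u$, $|\sigma-\sigma_1|<\delta$, $\|\sigma(u\wedge w)-\sigma_1(u_1\wedge v_1)\|<\delta$, and, for one common choice of sign, $\|u\mp u_1\|<\delta$ and $\|w\mp v_1\|<\delta$. (4) (Differentiability.) For every $t$, the map sending $(b',v')$ to the output obtained after exactly $t$ passes of the loop body is $C^\infty$ at $(b,v)$. If with threshold $\varepsilon$ the loop stops on $(b,v)$ after exactly $t$ passes and the last tested value is not equal to $\varepsilon$, then for all $(b',v')$ in a neighbourhood of $(b,v)$ the algorithm with threshold $\varepsilon$ returns this $t$-pass output; so the algorithm is $C^\infty$ at $(b,v)$. -/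

import Mathlib

open scoped InnerProductSpace ContDiff Topology Matrix
open Filter

namespace GAPower

/-- The space `ℝⁿ` of vectors, with the Euclidean inner product. -/
abbrev Vec (n : ℕ) : Type := EuclideanSpace ℝ (Fin n)

/-- The quadratic form `v ↦ ‖v‖²` of signature `(n, 0)`. -/
noncomputable def quadForm (n : ℕ) : QuadraticForm ℝ (Vec n) :=
  LinearMap.BilinMap.toQuadraticMap (innerₗ (Vec n))

/-- The Clifford algebra `Cl(n) = Cl(n, 0)`. -/
abbrev Cl (n : ℕ) : Type := CliffordAlgebra (quadForm n)

/-- The inclusion of vectors as the grade one part `Cl¹(n)`. -/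
noncomputable def vec {n : ℕ} : Vec n →ₗ[ℝ] Cl n := CliffordAlgebra.ι (quadForm n)

/-- The grade zero (scalar) part of a multivector. -/
noncomputable def scalarPart {n : ℕ} : Cl n →ₗ[ℝ] ℝ :=
  (ExteriorAlgebra.algebraMapInv (R := ℝ) (M := Vec n)).toLinearMap ∘ₗ
    (CliffordAlgebra.equivExterior (quadForm n)).toLinearMap

/-- The grade one (vector) part of a multivector. -/
noncomputable def vectorPart {n : ℕ} : Cl n →ₗ[ℝ] Vec n :=
  (ExteriorAlgebra.ιInv (R := ℝ) (M := Vec n)) ∘ₗ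
    (CliffordAlgebra.equivExterior (quadForm n)).toLinearMap

/-- The outer product of two vectors in `Cl(n)`, so that `u v = u · v + u ∧ v`. -/
noncomputable def wedgeCl {n : ℕ} (u v : Vec n) : Cl n :=
  vec u * vec v - algebraMap ℝ (Cl n) ⟪u, v⟫_ℝ

/-- The subspace `Cl²(n)` of bivectors: linear combinations of outer products of two vectors. -/
noncomputable def bivectors (n : ℕ) : Submodule ℝ (Cl n) :=
  Submodule.span ℝ (Set.range fun p : Vec n × Vec n => wedgeCl p.1 p.2)

/-- The type of bivectors. -/
abbrev Bivector (n : ℕ) : Type := ↥(bivectors n)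

/-- The outer product of two vectors, as a bivector. -/
noncomputable def wedge {n : ℕ} (u v : Vec n) : Bivector n :=
  ⟨wedgeCl u v, Submodule.subset_span ⟨(u, v), rfl⟩⟩

theorem quadForm_apply {n : ℕ} (v : Vec n) : quadForm n v = ⟪v, v⟫_ℝ := rfl

theorem vec_mul_vec_add {n : ℕ} (u v : Vec n) :
    vec u * vec v + vec v * vec u = algebraMap ℝ (Cl n) (2 * ⟪u, v⟫_ℝ) := by
  have h := CliffordAlgebra.ι_mul_ι_add_swap (Q := quadForm n) u v
  rw [vec, h]
  congr 1
  simp only [QuadraticMap.polar, quadForm_apply, inner_add_left, inner_add_right,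
    real_inner_comm u v]
  ring

theorem associated_quadForm {n : ℕ} (u v : Vec n) :
    QuadraticMap.associated (R := ℝ) (quadForm n) u v = ⟪u, v⟫_ℝ := by
  rw [QuadraticMap.associated_apply]
  simp only [quadForm_apply, inner_add_left, inner_add_right, real_inner_comm u v]
  simp
  ring

theorem scalarPart_algebraMap {n : ℕ} (r : ℝ) : scalarPart (algebraMap ℝ (Cl n) r) = r := by
  simp [scalarPart]

theorem scalarPart_vec_mul {n : ℕ} (u : Vec n) (x : Cl n) :
    scalarPart (vec u * x) =
      scalarPart (CliffordAlgebra.contractLeft (innerₗ (Vec n) u) x) := by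
  have hB : QuadraticMap.associated (R := ℝ) (-quadForm n) u = -(innerₗ (Vec n) u) := by
    ext v
    have := associated_quadForm u v
    simp only [map_neg, LinearMap.neg_apply, this]
    rfl
  simp only [scalarPart, vec, LinearMap.comp_apply, LinearEquiv.coe_coe,
    CliffordAlgebra.equivExterior, CliffordAlgebra.changeFormEquiv_apply, AlgHom.toLinearMap_apply]
  rw [CliffordAlgebra.changeForm_ι_mul, hB, CliffordAlgebra.changeForm_contractLeft]
  simp only [map_neg, LinearMap.neg_apply, sub_neg_eq_add, map_add]
  have : ExteriorAlgebra.algebraMapInv (R := ℝ) (M := Vec n)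
    ((CliffordAlgebra.ι (0 : QuadraticForm ℝ (Vec n))) u) = 0 :=
      ExteriorAlgebra.lift_ι_apply ℝ (0 : Vec n →ₗ[ℝ] ℝ) (by simp) u
  erw [map_mul, this]
  simp

theorem scalarPart_wedge_mul_wedge {n : ℕ} (a b c d : Vec n) :
    scalarPart (CliffordAlgebra.reverse (wedgeCl a b) * wedgeCl c d) =
      ⟪a, c⟫_ℝ * ⟪b, d⟫_ℝ - ⟪a, d⟫_ℝ * ⟪b, c⟫_ℝ := by
  have h2 : ∀ u v : Vec n, scalarPart (vec u * vec v) = ⟪u, v⟫_ℝ := by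
    intro u v
    rw [scalarPart_vec_mul, vec, CliffordAlgebra.contractLeft_ι, scalarPart_algebraMap]
    rfl
  have h4 : scalarPart (vec b * (vec a * (vec c * vec d))) =
      ⟪b, a⟫_ℝ * ⟪c, d⟫_ℝ - ⟪b, c⟫_ℝ * ⟪a, d⟫_ℝ + ⟪b, d⟫_ℝ * ⟪a, c⟫_ℝ := by
    rw [scalarPart_vec_mul]
    have : CliffordAlgebra.contractLeft (innerₗ (Vec n) b) (vec a * (vec c * vec d)) =
        ⟪b, a⟫_ℝ • (vec c * vec d) - ⟪b, c⟫_ℝ • (vec a * vec d) + ⟪b, d⟫_ℝ • (vec a * vec c) := by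
      simp only [vec]
      rw [CliffordAlgebra.contractLeft_ι_mul, CliffordAlgebra.contractLeft_ι_mul,
        CliffordAlgebra.contractLeft_ι]
      simp only [innerₗ_apply_apply, mul_sub, mul_smul_comm, ← Algebra.commutes,
        ← Algebra.smul_def]
      abel
    rw [this]
    simp only [map_add, map_sub, map_smul, h2, smul_eq_mul]
  have hrev : CliffordAlgebra.reverse (wedgeCl a b) =
      vec b * vec a - algebraMap ℝ (Cl n) ⟪a, b⟫_ℝ := by
    simp only [wedgeCl, vec, map_sub, CliffordAlgebra.reverse.map_mul, CliffordAlgebra.reverse_ι,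
      CliffordAlgebra.reverse.commutes]
  rw [hrev, wedgeCl, sub_mul, mul_sub, mul_sub, ← Algebra.commutes, ← Algebra.smul_def,
    ← Algebra.smul_def, ← Algebra.smul_def, mul_assoc]
  simp only [map_sub, map_smul, h2, h4, smul_eq_mul, scalarPart_algebraMap]
  rw [real_inner_comm a b]
  ring

/-- The canonical bilinear form `⟨x, y⟩ = ⟨x† y⟩₀` on bivectors, where `x†` is the reversion. -/
noncomputable def bivectorForm {n : ℕ} : Bivector n →ₗ[ℝ] Bivector n →ₗ[ℝ] ℝ :=
  ((LinearMap.mul ℝ (Cl n)).compr₂ scalarPart).compl₁₂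
    (CliffordAlgebra.reverse ∘ₗ (bivectors n).subtype) (bivectors n).subtype

theorem bivectorForm_wedge {n : ℕ} (a b c d : Vec n) :
    bivectorForm (wedge a b) (wedge c d) =
      ⟪a, c⟫_ℝ * ⟪b, d⟫_ℝ - ⟪a, d⟫_ℝ * ⟪b, c⟫_ℝ :=
  scalarPart_wedge_mul_wedge a b c d

/-- Two linear maps that agree on outer products of vectors agree on bivectors. -/
theorem bivector_hom_ext {n : ℕ} {M : Type*} [AddCommGroup M] [Module ℝ M]
    {f g : Bivector n →ₗ[ℝ] M} (h : ∀ u v : Vec n, f (wedge u v) = g (wedge u v)) : f = g := by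
  ext ⟨x, hx⟩
  induction hx using Submodule.span_induction with
  | mem x hx =>
    obtain ⟨p, rfl⟩ := hx
    exact h p.1 p.2
  | zero => exact (map_zero f).trans (map_zero g).symm
  | add x y hx hy ihx ihy =>
    have := congrArg₂ (· + ·) ihx ihy
    rwa [← map_add, ← map_add] at this
  | smul r x hx ih =>
    have := congrArg (r • ·) ih
    rwa [← map_smul, ← map_smul] at this

theorem bivectorForm_symm {n : ℕ} (x y : Bivector n) : bivectorForm x y = bivectorForm y x := by
  have : (bivectorForm (n := n)) = bivectorForm.flip := by
    refine bivector_hom_ext fun a b => bivector_hom_ext fun c d => ?_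
    rw [LinearMap.flip_apply, bivectorForm_wedge, bivectorForm_wedge]
    rw [real_inner_comm a c, real_inner_comm b d, real_inner_comm a d, real_inner_comm b c]
    ring
  exact congrArg (fun f => f x y) this

/-- The standard basis vector `eᵢ`. -/
noncomputable def stdVec {n : ℕ} (i : Fin n) : Vec n := EuclideanSpace.single i 1

/-- The outer product as a bilinear map. -/
noncomputable def wedgeₗ {n : ℕ} : Vec n →ₗ[ℝ] Vec n →ₗ[ℝ] Bivector n :=
  LinearMap.mk₂ ℝ wedge
    (fun u u' v => Subtype.ext (by
      simp only [wedge, wedgeCl, Submodule.coe_add, map_add, add_mul, inner_add_left]; abel))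
    (fun c u v => Subtype.ext (by
      simp only [wedge, wedgeCl, Submodule.coe_smul, map_smul, smul_mul_assoc, inner_smul_left,
        smul_sub, Algebra.algebraMap_eq_smul_one, smul_smul, conj_trivial]))
    (fun u v v' => Subtype.ext (by
      simp only [wedge, wedgeCl, Submodule.coe_add, map_add, mul_add, inner_add_right]; abel))
    (fun c u v => Subtype.ext (by
      simp only [wedge, wedgeCl, Submodule.coe_smul, map_smul, mul_smul_comm, inner_smul_right,
        smul_sub, Algebra.algebraMap_eq_smul_one, smul_smul]))

theorem wedge_antisymm {n : ℕ} (u v : Vec n) : wedge u v = -wedge v u := by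
  apply Subtype.ext
  have h := vec_mul_vec_add u v
  rw [two_mul, map_add] at h
  simp only [wedge, wedgeCl, Submodule.coe_neg, real_inner_comm u v]
  rw [neg_sub, sub_eq_sub_iff_add_eq_add, h]

theorem vec_expand {n : ℕ} (u : Vec n) : u = ∑ i, u i • stdVec i := by
  ext j
  simp [stdVec, Pi.single_apply]

theorem wedge_expand {n : ℕ} (u v : Vec n) :
    wedge u v = ∑ i, ∑ j, (u i * v j) • wedge (stdVec i) (stdVec j) := by
  have h : wedgeₗ u v = ∑ i, ∑ j, (u i * v j) • wedgeₗ (stdVec i) (stdVec j) := by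
    conv_lhs => rw [vec_expand u, vec_expand v]
    simp only [map_sum, map_smul, LinearMap.sum_apply, LinearMap.smul_apply, Finset.smul_sum,
      smul_smul]
    rw [Finset.sum_comm]
    simp only [mul_comm]
  exact h

/-- A bivector is determined by its pairings with the basis bivectors. -/
theorem bivector_expand {n : ℕ} (x : Bivector n) :
    x = (2⁻¹ : ℝ) • ∑ i, ∑ j,
      bivectorForm (wedge (stdVec i) (stdVec j)) x • wedge (stdVec i) (stdVec j) := by
  let F : Bivector n →ₗ[ℝ] Bivector n := (2⁻¹ : ℝ) • ∑ i, ∑ j,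
    (bivectorForm (wedge (stdVec i) (stdVec j))).smulRight (wedge (stdVec i) (stdVec j))
  have hF : (LinearMap.id : Bivector n →ₗ[ℝ] Bivector n) = F := by
    refine bivector_hom_ext fun u v => ?_
    have hi : ∀ (i : Fin n) (w : Vec n), ⟪stdVec i, w⟫_ℝ = w i := by
      intro i w
      simp [stdVec, EuclideanSpace.inner_single_left]
    simp only [F, LinearMap.smul_apply, LinearMap.sum_apply, LinearMap.smulRight_apply,
      bivectorForm_wedge, hi, LinearMap.id_apply, sub_smul, Finset.sum_sub_distrib]
    rw [← wedge_expand u v]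
    have : ∑ i, ∑ j, (v i * u j) • wedge (stdVec i) (stdVec j) = wedge v u :=
      (wedge_expand v u).symm
    rw [this, wedge_antisymm v u]
    rw [sub_neg_eq_add, ← two_smul ℝ, smul_smul]
    norm_num
  have := congrArg (fun f => f x) hF
  simpa [F] using this

theorem bivectorForm_self {n : ℕ} (x : Bivector n) :
    bivectorForm x x =
      2⁻¹ * ∑ i, ∑ j, bivectorForm (wedge (stdVec i) (stdVec j)) x ^ 2 := by
  have h := congrArg (fun y => bivectorForm y x) (bivector_expand x)
  simpa only [map_smul, map_sum, LinearMap.smul_apply, LinearMap.sum_apply, smul_eq_mul,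
    pow_two] using h

/-- The inner product `⟨x, y⟩ = ⟨x† y⟩₀` on bivectors. -/
noncomputable abbrev bivectorCore (n : ℕ) : InnerProductSpace.Core ℝ (Bivector n) where
  inner x y := bivectorForm x y
  conj_inner_symm x y := bivectorForm_symm y x
  re_inner_nonneg x := by
    rw [bivectorForm_self]
    exact mul_nonneg (by norm_num) (Finset.sum_nonneg fun i _ => Finset.sum_nonneg fun j _ =>
      sq_nonneg _)
  add_left x y z := by rw [map_add, LinearMap.add_apply]
  smul_left x y r := by rw [map_smul]; rfl
  definite x hx := by
    rw [bivectorForm_self] at hx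
    have h0 : ∀ i j : Fin n, bivectorForm (wedge (stdVec i) (stdVec j)) x = 0 := by
      intro i j
      have h1 : ∑ i : Fin n, ∑ j : Fin n,
        bivectorForm (wedge (stdVec i) (stdVec j)) x ^ 2 = 0 := by linarith
      rw [Finset.sum_eq_zero_iff_of_nonneg
        (fun i _ => Finset.sum_nonneg fun j _ => sq_nonneg _)] at h1
      have h2 := h1 i (Finset.mem_univ i)
      rw [Finset.sum_eq_zero_iff_of_nonneg (fun j _ => sq_nonneg _)] at h2
      exact pow_eq_zero_iff (two_ne_zero) |>.mp (h2 j (Finset.mem_univ j))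
    rw [bivector_expand x]
    simp [h0]

noncomputable instance instNormedBivector (n : ℕ) : NormedAddCommGroup (Bivector n) :=
  (bivectorCore n).toNormedAddCommGroup

noncomputable instance instInnerBivector (n : ℕ) : InnerProductSpace ℝ (Bivector n) :=
  InnerProductSpace.ofCore (bivectorCore n).toCore

/-- The right contraction `b ⌞ v` of a bivector by a vector, as a linear map in the vector `v`. -/
noncomputable def contract {n : ℕ} (b : Bivector n) : Vec n →ₗ[ℝ] Vec n :=
  vectorPart ∘ₗ CliffordAlgebra.contractRight (b : Cl n) ∘ₗ innerₗ (Vec n)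

theorem contractRight_wedge {n : ℕ} (u w v : Vec n) :
    CliffordAlgebra.contractRight (wedge u w : Cl n) (innerₗ (Vec n) v) =
      vec (⟪w, v⟫_ℝ • u - ⟪u, v⟫_ℝ • w) := by
  simp only [wedge, wedgeCl, vec, map_sub, LinearMap.sub_apply, map_smul]
  rw [CliffordAlgebra.contractRight_mul_ι, CliffordAlgebra.contractRight_ι,
    CliffordAlgebra.contractRight_algebraMap, ← Algebra.smul_def, sub_zero]
  simp only [innerₗ_apply_apply, real_inner_comm v]

/-- The right contraction of a bivector by a vector is a vector. -/
theorem vec_contract {n : ℕ} (b : Bivector n) (v : Vec n) :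
    vec (contract b v) = CliffordAlgebra.contractRight (b : Cl n) (innerₗ (Vec n) v) := by
  have hv : ∀ w : Vec n, vectorPart (vec w) = w := by
    intro w
    simp only [vectorPart, vec, LinearMap.comp_apply, LinearEquiv.coe_coe,
      CliffordAlgebra.equivExterior, CliffordAlgebra.changeFormEquiv_apply,
      CliffordAlgebra.changeForm_ι]
    exact ExteriorAlgebra.ι_leftInverse w
  let G : Bivector n →ₗ[ℝ] Cl n :=
    (CliffordAlgebra.contractRight.flip (innerₗ (Vec n) v)) ∘ₗ (bivectors n).subtype
  have h : vec ∘ₗ vectorPart ∘ₗ G = G := by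
    refine bivector_hom_ext fun u w => ?_
    have : G (wedge u w) = vec (⟪w, v⟫_ℝ • u - ⟪u, v⟫_ℝ • w) := contractRight_wedge u w v
    simp only [LinearMap.comp_apply, this, hv]
  exact congrArg (fun f => f b) h

/-- The matrix of coefficients of a bivector with respect to the basis bivectors `eᵢ ∧ eⱼ`. -/
noncomputable def skewMatrix {n : ℕ} (b : Bivector n) : Matrix (Fin n) (Fin n) ℝ :=
  Matrix.of fun i j => ⟪wedge (stdVec i) (stdVec j), b⟫_ℝ

/-- The largest singular value `σ₁` of a bivector, acting on vectors by right contraction. -/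
noncomputable def topSingularValue {n : ℕ} (b : Bivector n) : ℝ :=
  (contract b).singularValues 0

/-- The dominant eigenspace of `v ↦ b ⌞ (b ⌞ v)`, for the eigenvalue `-σ₁²` of largest modulus.
When `σ₁ > 0` has multiplicity two, it is the plane of the dominant simple component of `b`. -/
noncomputable def dominantSpace {n : ℕ} (b : Bivector n) : Submodule ℝ (Vec n) :=
  Module.End.eigenspace (contract b ∘ₗ contract b) (-topSingularValue b ^ 2)

/-- A bivector is simple if it is the outer product of two vectors. -/
def IsSimple {n : ℕ} (s : Bivector n) : Prop := ∃ u v : Vec n, s = wedge u v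

/-- `s` is a best approximation of `b` among the simple bivectors. -/
def IsSimpleProjection {n : ℕ} (b s : Bivector n) : Prop :=
  IsSimple s ∧ ∀ s' : Bivector n, IsSimple s' → ‖b - s‖ ≤ ‖b - s'‖

/-- `s` is a best approximation of `b` among all matrices of rank at most two, in the
Frobenius norm. -/
def IsBestRankTwo {n : ℕ} (b s : Bivector n) : Prop :=
  (skewMatrix s).rank ≤ 2 ∧ ∀ M : Matrix (Fin n) (Fin n) ℝ, M.rank ≤ 2 →
    ∑ i, ∑ j, (skewMatrix b i j - skewMatrix s i j) ^ 2 ≤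
      ∑ i, ∑ j, (skewMatrix b i j - M i j) ^ 2

/-- One pass of the loop body: `v ← b ⌞ (b ⌞ v)`, then `v ← v / ‖v‖`. -/
noncomputable def powerStep {n : ℕ} (b : Bivector n) (v : Vec n) : Vec n :=
  ‖contract b (contract b v)‖⁻¹ • contract b (contract b v)

/-- The values of the variables `(v, v_prev)` after `t` passes of the loop body, started from
`v_prev = v`. -/
noncomputable def loopState {n : ℕ} (b : Bivector n) (v : Vec n) (t : ℕ) : Vec n × Vec n :=
  (fun p : Vec n × Vec n => (powerStep b p.1, p.1))^[t] (v, v)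

/-- The quantity `‖v + v_prev‖` tested by the loop after `t` passes of the loop body. -/
noncomputable def loopGap {n : ℕ} (b : Bivector n) (v : Vec n) (t : ℕ) : ℝ :=
  ‖(loopState b v t).1 + (loopState b v t).2‖

/-- What is returned if the loop is left after `t` passes: with `v` the current vector and
`σ u = b ⌞ v`, the pair `(σ u ∧ v, v)`. -/
noncomputable def outputAfter {n : ℕ} (t : ℕ) (b : Bivector n) (v : Vec n) :
    Bivector n × Vec n :=
  (wedge (contract b (loopState b v t).1) (loopState b v t).1, (loopState b v t).1)

/-- The loop runs while `‖v + v_prev‖ > ε`: it is left after exactly `t` passes. -/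
def HaltsAfter {n : ℕ} (b : Bivector n) (v : Vec n) (ε : ℝ) (t : ℕ) : Prop :=
  (∀ k < t, ε < loopGap b v k) ∧ loopGap b v t ≤ ε

open scoped Classical in
/-- The power iteration algorithm; the value is `none` if the loop does not terminate. -/
noncomputable def gaPowerIteration {n : ℕ} (b : Bivector n) (v : Vec n) (ε : ℝ) :
    Option (Bivector n × Vec n) :=
  if h : ∃ t, HaltsAfter b v ε t then some (outputAfter h.choose b v) else none

end GAPower

open GAPower

/-! The identity `inner_wedge_left`, which pairs `b` with `u ∧ w` through the contraction `A =
contract b`, turns everything into linear algebra of the skew map `A`. Since `A* = -A`, the map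
`-A²` is symmetric with eigenvalues the squared singular values. Hence `S = -A²/σ₁²`
(`scaledSquare`) has eigenvalues in `[0, 1]` and fixes exactly the dominant space `E`, so `S ^ t v`
tends to the orthogonal projection of `v` onto `E` (`tendsto_scaledSquare_pow`). One pass sends `y`
to `-S y / ‖S y‖`; up to the sign `(-1)^t` the iterates are therefore the normalized `S ^ t v`, with
limit the normalized projection `v₁`, and the tested gaps tend to `0`. Put `u₁ = A v₁ / σ₁`.

For orthonormal `u, w`, `‖b - a (u ∧ w)‖² = ‖b‖² - 2a⟪u, A w⟫ + a²` is at least `‖b‖² - σ₁²`, with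
equality at `σ₁ (u₁ ∧ v₁)`; when `E` is a plane the equality case forces uniqueness. For matrices of
rank at most two, `frobenius_sub_ge` gives the same bound, doubled, by projecting columns onto the
column space.

Small thresholds force late stopping, unless a gap vanishes, and then the iterate is already at its
limit up to sign (`exists_threshold`). Smoothness holds because bilinear maps are composed with
normalizations of nonzero vectors, and the strict tests are open conditions. -/

namespace GAPower

/-! ### Contraction by a bivector as a skew map -/

section Algebra

variable {n : ℕ}

theorem vec_injective : Function.Injective (vec (n := n)) := by
  intro x y h
  have hv : ∀ w : Vec n, vectorPart (vec w) = w := by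
    intro w
    simp only [vectorPart, vec, LinearMap.comp_apply, LinearEquiv.coe_coe,
      CliffordAlgebra.equivExterior, CliffordAlgebra.changeFormEquiv_apply,
      CliffordAlgebra.changeForm_ι]
    exact ExteriorAlgebra.ι_leftInverse w
  rw [← hv x, h, hv]

theorem contract_wedge (u w v : Vec n) :
    contract (wedge u w) v = ⟪w, v⟫_ℝ • u - ⟪u, v⟫_ℝ • w :=
  vec_injective (by rw [vec_contract, contractRight_wedge])

/-- The right contraction as a bilinear map. -/
noncomputable def contractₗ : Bivector n →ₗ[ℝ] Vec n →ₗ[ℝ] Vec n where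
  toFun := contract
  map_add' a b := by
    ext1 v
    apply vec_injective
    simp [vec_contract]
  map_smul' c b := by
    ext1 v
    apply vec_injective
    simp [vec_contract]

@[simp] theorem contractₗ_apply (b : Bivector n) : contractₗ b = contract b := rfl

theorem inner_wedge_wedge (a b c d : Vec n) :
    ⟪wedge a b, wedge c d⟫_ℝ = ⟪a, c⟫_ℝ * ⟪b, d⟫_ℝ - ⟪a, d⟫_ℝ * ⟪b, c⟫_ℝ :=
  bivectorForm_wedge a b c d

/-- Both sides are linear in `b`, so it suffices to compare them on outer products. This is the
bridge from the Clifford inner product to the contraction. -/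
theorem inner_wedge_left (u w : Vec n) (b : Bivector n) :
    ⟪wedge u w, b⟫_ℝ = ⟪u, contract b w⟫_ℝ := by
  have h : innerₗ (Bivector n) (wedge u w) = innerₗ (Vec n) u ∘ₗ contractₗ.flip w := by
    refine bivector_hom_ext fun x y => ?_
    simp only [innerₗ_apply_apply, LinearMap.comp_apply, LinearMap.flip_apply, contractₗ_apply,
      contract_wedge, inner_wedge_wedge, inner_sub_right, inner_smul_right, real_inner_comm w]
    ring
  exact congrArg (fun f => f b) h

theorem contract_skew (b : Bivector n) (x y : Vec n) :
    ⟪contract b x, y⟫_ℝ = -⟪x, contract b y⟫_ℝ := by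
  rw [← inner_wedge_left, wedge_antisymm, inner_neg_left, inner_wedge_left, neg_neg,
    real_inner_comm]

theorem inner_contract_self (b : Bivector n) (x : Vec n) : ⟪contract b x, x⟫_ℝ = 0 := by
  have := contract_skew b x x
  rw [real_inner_comm] at this ⊢
  linarith

theorem skewMatrix_apply (b : Bivector n) (i j : Fin n) :
    skewMatrix b i j = contract b (stdVec j) i := by
  rw [skewMatrix, Matrix.of_apply, inner_wedge_left]
  simp [stdVec, EuclideanSpace.inner_single_left]

theorem skewMatrix_transpose (b : Bivector n) : (skewMatrix b)ᵀ = -skewMatrix b := by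
  ext i j
  rw [Matrix.transpose_apply, Matrix.neg_apply, skewMatrix, Matrix.of_apply, Matrix.of_apply,
    wedge_antisymm, inner_neg_left]

theorem contract_eq_mulVec (b : Bivector n) (v : Vec n) :
    contract b v = WithLp.toLp 2 (skewMatrix b *ᵥ v.ofLp) := by
  ext i
  conv_lhs => rw [vec_expand v, map_sum]
  simp only [map_smul, Matrix.mulVec, dotProduct, skewMatrix_apply, WithLp.ofLp_sum,
    Finset.sum_apply, PiLp.smul_apply, smul_eq_mul, mul_comm]

theorem bivector_eq_sum (b : Bivector n) :
    b = ∑ i, ∑ j ∈ Finset.Ioi i, skewMatrix b i j • wedge (stdVec i) (stdVec j) := by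
  set F : Fin n → Fin n → Bivector n := fun i j => skewMatrix b i j • wedge (stdVec i) (stdVec j)
    with hF
  have hsymm : ∀ i j, F i j = F j i := by
    intro i j
    have h : skewMatrix b i j = -skewMatrix b j i :=
      congrFun (congrFun (skewMatrix_transpose b) j) i
    simp only [hF]
    rw [h, wedge_antisymm, neg_smul, smul_neg, neg_neg]
  have hdiag : ∀ i, F i i = 0 := by
    intro i
    have h : skewMatrix b i i = -skewMatrix b i i :=
      congrFun (congrFun (skewMatrix_transpose b) i) i
    have h0 : skewMatrix b i i = 0 := by linarith
    simp only [hF, h0, zero_smul]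
  have hb : b = (2⁻¹ : ℝ) • ∑ i, ∑ j, F i j := bivector_expand b
  -- `bivector_expand` counts every pair twice with weight one half; symmetry of `F` folds the part
  -- below the diagonal onto the part above.
  have hsplit : ∀ i, ∑ j, F i j = ∑ j ∈ Finset.Ioi i, F i j + ∑ j ∈ Finset.Iio i, F i j := by
    intro i
    have hu : (Finset.univ : Finset (Fin n)) =
        insert i (Finset.Ioi i ∪ Finset.Iio i) := by
      ext j
      simp only [Finset.mem_univ, Finset.mem_insert, Finset.mem_union, Finset.mem_Ioi,
        Finset.mem_Iio, true_iff]
      rcases lt_trichotomy i j with h | h | h <;> simp [h]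
    rw [hu, Finset.sum_insert (by simp), hdiag, zero_add, Finset.sum_union]
    rw [Finset.disjoint_left]
    intro j h1 h2
    rw [Finset.mem_Ioi] at h1
    rw [Finset.mem_Iio] at h2
    exact lt_asymm h1 h2
  have hswap : ∑ i, ∑ j ∈ Finset.Iio i, F i j = ∑ i, ∑ j ∈ Finset.Ioi i, F i j := by
    rw [Finset.sum_comm' (t' := Finset.univ) (s' := fun j => Finset.Ioi j) (by simp)]
    exact Finset.sum_congr rfl fun i _ => Finset.sum_congr rfl fun j _ => hsymm _ _
  conv_lhs => rw [hb]
  rw [Finset.sum_congr rfl fun i _ => hsplit i, Finset.sum_add_distrib, hswap, ← two_smul ℝ,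
    smul_smul]
  norm_num [hF]

theorem norm_sq_bivector (b : Bivector n) :
    ‖b‖ ^ 2 = 2⁻¹ * ∑ i, ∑ j, skewMatrix b i j ^ 2 := by
  rw [← real_inner_self_eq_norm_sq]
  exact bivectorForm_self b

theorem contract_ne_zero {b : Bivector n} (hb : b ≠ 0) : contract b ≠ 0 := by
  intro h
  apply hb
  have : ‖b‖ ^ 2 = 0 := by
    rw [norm_sq_bivector]
    simp [skewMatrix_apply, h]
  simpa using this

/-- A bivector is determined by its contraction, so bivectors embed in the endomorphisms of `ℝⁿ`.
This makes (bi)linear maps on them automatically smooth later. -/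
instance finiteDimensional_bivector : FiniteDimensional ℝ (Bivector n) := by
  refine Module.Finite.of_injective (contractₗ (n := n)) ?_
  rw [injective_iff_map_eq_zero]
  intro b hb
  by_contra h
  exact contract_ne_zero h hb

end Algebra

/-! ### Spectral theory of the squared contraction -/

section Spectral

variable {n : ℕ} (b : Bivector n)

theorem topSingularValue_nonneg : 0 ≤ topSingularValue b :=
  (contract b).singularValues_nonneg 0

theorem topSingularValue_pos {b : Bivector n} (hb : b ≠ 0) : 0 < topSingularValue b := by
  refine (LinearMap.singularValues_pos_iff_lt_finrank_range _).2 ?_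
  rw [Nat.pos_iff_ne_zero, Ne, Submodule.finrank_eq_zero, LinearMap.range_eq_bot]
  exact contract_ne_zero hb

theorem adjoint_contract : LinearMap.adjoint (contract b) = -contract b := by
  symm
  rw [LinearMap.eq_adjoint_iff]
  intro x y
  rw [LinearMap.neg_apply, inner_neg_left, contract_skew, neg_neg]

/-- Orthonormal eigenbasis of the square of the contraction by a bivector. -/
theorem exists_eigenbasis : ∃ (e : OrthonormalBasis (Fin n) ℝ (Vec n)) (s : Fin n → ℝ),
    ∀ i, 0 ≤ s i ∧ s i ≤ topSingularValue b ∧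
      contract b (contract b (e i)) = -(s i ^ 2 • e i) := by
  have hn : Module.finrank ℝ (Vec n) = n := by simp
  -- By skewness `A*A = -A²`, so right singular vectors of `A` are eigenvectors of `A²`. Singular
  -- values decrease from index `0`.
  refine ⟨(contract b).isSymmetric_adjoint_comp_self.eigenvectorBasis hn,
    fun i => (contract b).singularValues i, fun i =>
      ⟨(contract b).singularValues_nonneg i,
        (contract b).singularValues_antitone (Nat.zero_le i), ?_⟩⟩
  have h := (contract b).isSymmetric_adjoint_comp_self.apply_eigenvectorBasis hn i
  rw [← LinearMap.sq_singularValues_fin] at h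
  rw [LinearMap.comp_apply, LinearMap.congr_fun (adjoint_contract b), LinearMap.neg_apply,
    neg_eq_iff_eq_neg] at h
  exact h

theorem norm_contract_sq (v : Vec n) :
    ‖contract b v‖ ^ 2 = -⟪contract b (contract b v), v⟫_ℝ := by
  rw [contract_skew, neg_neg, real_inner_self_eq_norm_sq]

/-- By Parseval in the eigenbasis, `‖A v‖² = ∑ sᵢ² ⟪eᵢ, v⟫²`. -/
theorem norm_contract_le (v : Vec n) : ‖contract b v‖ ≤ topSingularValue b * ‖v‖ := by
  obtain ⟨e, s, hs⟩ := exists_eigenbasis b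
  have h0 := topSingularValue_nonneg b
  refine (sq_le_sq₀ (norm_nonneg _) (by positivity)).1 ?_
  rw [norm_contract_sq, ← OrthonormalBasis.sum_inner_mul_inner e, mul_pow,
    ← OrthonormalBasis.sum_sq_norm_inner_right e v, Finset.mul_sum, ← Finset.sum_neg_distrib]
  refine Finset.sum_le_sum fun i _ => ?_
  have h1 : ⟪contract b (contract b v), e i⟫_ℝ = -(s i ^ 2 * ⟪e i, v⟫_ℝ) := by
    rw [contract_skew, contract_skew, neg_neg, (hs i).2.2, inner_neg_right, inner_smul_right,
      real_inner_comm]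
  have h2 : s i ^ 2 ≤ topSingularValue b ^ 2 := pow_le_pow_left₀ (hs i).1 (hs i).2.1 2
  rw [h1, Real.norm_eq_abs, sq_abs]
  nlinarith [mul_le_mul_of_nonneg_right h2 (sq_nonneg ⟪e i, v⟫_ℝ)]

theorem mem_dominantSpace {v : Vec n} :
    v ∈ dominantSpace b ↔ contract b (contract b v) = -(topSingularValue b ^ 2 • v) := by
  rw [dominantSpace, Module.End.mem_eigenspace_iff, LinearMap.comp_apply, neg_smul]

/-- The equality case of `norm_contract_le`: expanding `‖A² v + σ₁² v‖²` and bounding `‖A² v‖` by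
`σ₁ ‖A v‖` leaves at most `σ₁⁴‖v‖² (1 - 2 + 1) = 0`. -/
theorem mem_dominantSpace_of_norm_contract {v : Vec n}
    (h : ‖contract b v‖ = topSingularValue b * ‖v‖) : v ∈ dominantSpace b := by
  rw [mem_dominantSpace, ← add_eq_zero_iff_eq_neg, ← norm_eq_zero, ← sq_eq_zero_iff]
  refine le_antisymm ?_ (sq_nonneg _)
  have h1 := norm_contract_le b (contract b v)
  have h2 := norm_contract_sq b v
  have h3 : ‖contract b (contract b v)‖ ^ 2 ≤ (topSingularValue b * ‖contract b v‖) ^ 2 :=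
    pow_le_pow_left₀ (norm_nonneg _) h1 2
  have h4 : ⟪contract b (contract b v), v⟫_ℝ = -(topSingularValue b * ‖v‖) ^ 2 := by
    rw [← h, h2, neg_neg]
  rw [norm_add_sq_real, inner_smul_right, norm_smul, h4, Real.norm_of_nonneg (sq_nonneg _)]
  rw [h] at h3
  nlinarith

theorem contract_mem_dominantSpace {v : Vec n} (h : v ∈ dominantSpace b) :
    contract b v ∈ dominantSpace b := by
  rw [mem_dominantSpace] at h ⊢
  rw [h, map_neg, map_smul]

end Spectral

/-! ### Convergence and termination of the power iteration -/

section PowerIteration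

variable {n : ℕ} {b : Bivector n}

/-- The square of the contraction, rescaled to be the identity on the dominant eigenspace. -/
noncomputable def scaledSquare (b : Bivector n) : Module.End ℝ (Vec n) :=
  (-(topSingularValue b ^ 2)⁻¹ : ℝ) • (contract b ∘ₗ contract b)

theorem contract_contract_eq (hb : b ≠ 0) (v : Vec n) :
    contract b (contract b v) = -(topSingularValue b ^ 2 • scaledSquare b v) := by
  have := (pow_pos (topSingularValue_pos hb) 2).ne'
  simp only [scaledSquare, LinearMap.smul_apply, LinearMap.neg_apply, LinearMap.comp_apply, neg_smul, smul_neg,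
    smul_smul, mul_inv_cancel₀ this, one_smul, neg_neg]

theorem mem_dominantSpace_iff_scaledSquare (hb : b ≠ 0) {v : Vec n} :
    v ∈ dominantSpace b ↔ scaledSquare b v = v := by
  rw [mem_dominantSpace, contract_contract_eq hb, neg_inj]
  exact (smul_right_injective _ (pow_pos (topSingularValue_pos hb) 2).ne').eq_iff

theorem scaledSquare_symm (x y : Vec n) :
    ⟪scaledSquare b x, y⟫_ℝ = ⟪x, scaledSquare b y⟫_ℝ := by
  simp only [scaledSquare, LinearMap.smul_apply, LinearMap.comp_apply, inner_smul_left,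
    inner_smul_right, contract_skew, neg_neg, conj_trivial]

/-- `S` is symmetric and fixes `E`, so the component of the iterates along `E` is conserved. This
excludes division by zero and identifies the limit. -/
theorem inner_scaledSquare_pow (hb : b ≠ 0) (v : Vec n) {x : Vec n} (hx : x ∈ dominantSpace b)
    (t : ℕ) : ⟪(scaledSquare b ^ t) v, x⟫_ℝ = ⟪v, x⟫_ℝ := by
  induction t with
  | zero => rfl
  | succ t ih =>
    rw [pow_succ', Module.End.mul_apply, scaledSquare_symm,
      (mem_dominantSpace_iff_scaledSquare hb).1 hx, ih]

theorem scaledSquare_pow_ne_zero (hb : b ≠ 0) {v : Vec n}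
    (hv : (dominantSpace b).starProjection v ≠ 0) (t : ℕ) : (scaledSquare b ^ t) v ≠ 0 := by
  intro h
  have h1 := inner_scaledSquare_pow hb v (Submodule.starProjection_apply_mem (dominantSpace b) v) t
  rw [h, inner_zero_left] at h1
  have h2 : ⟪v - (dominantSpace b).starProjection v, (dominantSpace b).starProjection v⟫_ℝ = 0 :=
    Submodule.starProjection_inner_eq_zero v _ (Submodule.starProjection_apply_mem _ v)
  rw [inner_sub_left, ← h1, zero_sub, neg_eq_zero, inner_self_eq_zero] at h2
  exact hv h2

theorem tendsto_scaledSquare_pow (hb : b ≠ 0) (v : Vec n) :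
    Tendsto (fun t => (scaledSquare b ^ t) v) atTop (𝓝 ((dominantSpace b).starProjection v)) := by
  obtain ⟨e, s, hs⟩ := exists_eigenbasis b
  have hσ := topSingularValue_pos hb
  set r : Fin n → ℝ := fun i => (s i / topSingularValue b) ^ 2 with hr
  have hS : ∀ i, scaledSquare b (e i) = r i • e i := by
    intro i
    simp only [scaledSquare, LinearMap.smul_apply, LinearMap.neg_apply, LinearMap.comp_apply, (hs i).2.2, hr,
      smul_neg, neg_smul, neg_neg, smul_smul]
    congr 1
    field_simp
  have hpow : ∀ t i, (scaledSquare b ^ t) (e i) = r i ^ t • e i := by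
    intro t i
    induction t with
    | zero => simp
    | succ t ih =>
      rw [pow_succ', Module.End.mul_apply, ih, map_smul, hS, smul_smul, pow_succ]
  -- All ratios lie in `[0, 1]`, so each coordinate converges, to `0` or to itself.
  have hlim : ∀ i, ∃ l : ℝ, Tendsto (fun t : ℕ => r i ^ t) atTop (𝓝 l) := by
    intro i
    have h0 : 0 ≤ r i := sq_nonneg _
    have h1 : r i ≤ 1 := by
      refine pow_le_one₀ (div_nonneg (hs i).1 hσ.le) ?_
      rw [div_le_one hσ]
      exact (hs i).2.1
    rcases h1.lt_or_eq with h | h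
    · exact ⟨0, tendsto_pow_atTop_nhds_zero_of_lt_one h0 h⟩
    · exact ⟨1, by simp [h]⟩
  choose l hl using hlim
  obtain ⟨p, hp⟩ : ∃ p, Tendsto (fun t => (scaledSquare b ^ t) v) atTop (𝓝 p) := by
    refine ⟨∑ i, ⟪e i, v⟫_ℝ • l i • e i, ?_⟩
    have h : ∀ t, (scaledSquare b ^ t) v = ∑ i, ⟪e i, v⟫_ℝ • r i ^ t • e i := by
      intro t
      conv_lhs => rw [← e.sum_repr' v]
      simp only [map_sum, map_smul, hpow]
    simp only [h]
    exact tendsto_finsetSum _ fun i _ => ((hl i).smul_const _).const_smul _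
  -- The limit need not be computed: being fixed by `S` it lies in `E`, and the conserved pairings
  -- make `v - p` orthogonal to `E`.
  have hpmem : p ∈ dominantSpace b := by
    rw [mem_dominantSpace_iff_scaledSquare hb]
    have h1 := (tendsto_add_atTop_iff_nat 1).2 hp
    have h2 := ((scaledSquare b).continuous_of_finiteDimensional.tendsto p).comp hp
    refine tendsto_nhds_unique h2 (h1.congr fun t => ?_)
    rw [pow_succ', Module.End.mul_apply]
    rfl
  rwa [Submodule.eq_starProjection_of_mem_of_inner_eq_zero hpmem]
  intro x hx
  have h1 : Tendsto (fun t => ⟪(scaledSquare b ^ t) v, x⟫_ℝ) atTop (𝓝 ⟪p, x⟫_ℝ) :=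
    hp.inner tendsto_const_nhds
  simp only [inner_scaledSquare_pow hb v hx] at h1
  rw [inner_sub_left, tendsto_nhds_unique tendsto_const_nhds h1, sub_self]

theorem loopState_zero (b : Bivector n) (v : Vec n) : loopState b v 0 = (v, v) := rfl

theorem loopState_succ (b : Bivector n) (v : Vec n) (t : ℕ) :
    loopState b v (t + 1) = (powerStep b (loopState b v t).1, (loopState b v t).1) := by
  rw [loopState, Function.iterate_succ_apply']
  rfl

theorem powerStep_neg (b : Bivector n) (y : Vec n) : powerStep b (-y) = -powerStep b y := by
  simp [powerStep]

theorem powerStep_smul (b : Bivector n) {c : ℝ} (hc : 0 < c) (y : Vec n) :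
    powerStep b (c • y) = powerStep b y := by
  simp only [powerStep, map_smul, norm_smul, Real.norm_of_nonneg hc.le, smul_smul, mul_inv]
  congr 1
  field_simp

theorem powerStep_eq (hb : b ≠ 0) (y : Vec n) :
    powerStep b y = -(‖scaledSquare b y‖⁻¹ • scaledSquare b y) := by
  have hσ := pow_pos (topSingularValue_pos hb) 2
  have hσ' := hσ.ne'
  simp only [powerStep, contract_contract_eq hb, norm_neg, norm_smul, Real.norm_of_nonneg hσ.le,
    smul_neg, smul_smul, mul_inv]
  rw [mul_right_comm, inv_mul_cancel₀ hσ', one_mul]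

/-- Intermediate normalizations are positive factors and do not affect later passes; only the sign
accumulates. The index is `t + 1` because the input need not be a unit vector. -/
theorem loopState_fst (hb : b ≠ 0) {v : Vec n} (hv : (dominantSpace b).starProjection v ≠ 0)
    (t : ℕ) : (loopState b v (t + 1)).1 =
      (-1 : ℝ) ^ (t + 1) • ‖(scaledSquare b ^ (t + 1)) v‖⁻¹ • (scaledSquare b ^ (t + 1)) v := by
  induction t with
  | zero =>
    rw [loopState_succ, loopState_zero, powerStep_eq hb]
    simp
  | succ t ih =>
    have hc : 0 < ‖(scaledSquare b ^ (t + 1)) v‖⁻¹ :=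
      inv_pos.2 (norm_pos_iff.2 (scaledSquare_pow_ne_zero hb hv _))
    have hneg : powerStep b (loopState b v (t + 1)).1 =
        (-1 : ℝ) ^ (t + 1) • powerStep b ((scaledSquare b ^ (t + 1)) v) := by
      rw [ih]
      rcases neg_one_pow_eq_or ℝ (t + 1) with h | h
      · rw [h, one_smul, one_smul, powerStep_smul b hc]
      · rw [h, neg_one_smul, neg_one_smul, powerStep_neg, powerStep_smul b hc]
    rw [loopState_succ, hneg, powerStep_eq hb, ← Module.End.mul_apply, ← pow_succ',
      pow_succ (-1 : ℝ) (t + 1), mul_neg_one, neg_smul, smul_neg]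

theorem exists_loopState_eq (hb : b ≠ 0) {v : Vec n}
    (hv : (dominantSpace b).starProjection v ≠ 0) (t : ℕ) :
    ∃ c : ℝ, c ≠ 0 ∧ (loopState b v t).1 = c • (scaledSquare b ^ t) v := by
  cases t with
  | zero => exact ⟨1, one_ne_zero, by simp [loopState_zero]⟩
  | succ t =>
    refine ⟨(-1) ^ (t + 1) * ‖(scaledSquare b ^ (t + 1)) v‖⁻¹, ?_, ?_⟩
    · exact mul_ne_zero (by simp) (inv_ne_zero (norm_ne_zero_iff.2
        (scaledSquare_pow_ne_zero hb hv _)))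
    · rw [loopState_fst hb hv, smul_smul]

theorem contract_contract_loopState_ne_zero (hb : b ≠ 0) {v : Vec n}
    (hv : (dominantSpace b).starProjection v ≠ 0) (t : ℕ) :
    contract b (contract b (loopState b v t).1) ≠ 0 := by
  obtain ⟨c, hc, h⟩ := exists_loopState_eq hb hv t
  rw [h, contract_contract_eq hb, map_smul, ← Module.End.mul_apply, ← pow_succ']
  exact neg_ne_zero.2 (smul_ne_zero (pow_pos (topSingularValue_pos hb) 2).ne'
    (smul_ne_zero hc (scaledSquare_pow_ne_zero hb hv _)))

theorem norm_loopState_succ (hb : b ≠ 0) {v : Vec n}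
    (hv : (dominantSpace b).starProjection v ≠ 0) (t : ℕ) : ‖(loopState b v (t + 1)).1‖ = 1 := by
  rw [loopState_succ, powerStep, norm_smul, norm_inv, norm_norm,
    inv_mul_cancel₀ (norm_ne_zero_iff.2 (contract_contract_loopState_ne_zero hb hv t))]

/-- The limit of the iterates, up to the alternating sign. -/
noncomputable def limitVec (b : Bivector n) (v : Vec n) : Vec n :=
  ‖(dominantSpace b).starProjection v‖⁻¹ • (dominantSpace b).starProjection v

theorem limitVec_mem (b : Bivector n) (v : Vec n) : limitVec b v ∈ dominantSpace b :=
  Submodule.smul_mem _ _ (Submodule.starProjection_apply_mem _ v)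

theorem norm_limitVec {v : Vec n} (hv : (dominantSpace b).starProjection v ≠ 0) :
    ‖limitVec b v‖ = 1 := by
  rw [limitVec, norm_smul, norm_inv, norm_norm, inv_mul_cancel₀ (norm_ne_zero_iff.2 hv)]

theorem tendsto_loopState (hb : b ≠ 0) {v : Vec n}
    (hv : (dominantSpace b).starProjection v ≠ 0) :
    Tendsto (fun t => (-1 : ℝ) ^ t • (loopState b v t).1) atTop (𝓝 (limitVec b v)) := by
  refine (tendsto_add_atTop_iff_nat 1).1 ?_
  have h := (tendsto_add_atTop_iff_nat 1).2 (tendsto_scaledSquare_pow hb v)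
  refine ((h.norm.inv₀ (norm_ne_zero_iff.2 hv)).smul h).congr fun t => ?_
  rw [loopState_fst hb hv, smul_smul ((-1 : ℝ) ^ _), ← mul_pow]
  simp

/-- Because signs alternate, the sum of consecutive iterates is, up to sign, a difference of
consecutive terms of a convergent sequence. -/
theorem tendsto_loopGap (hb : b ≠ 0) {v : Vec n}
    (hv : (dominantSpace b).starProjection v ≠ 0) :
    Tendsto (fun t => loopGap b v t) atTop (𝓝 0) := by
  refine (tendsto_add_atTop_iff_nat 1).1 ?_
  have h := tendsto_loopState hb hv
  have h2 := ((tendsto_add_atTop_iff_nat 1).2 h).sub h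
  rw [sub_self] at h2
  refine (h2.norm.congr fun t => ?_).trans (by simp)
  rw [loopGap, loopState_succ b v t, pow_succ, mul_neg_one, neg_smul, ← neg_add', norm_neg,
    ← smul_add, norm_smul, norm_pow, norm_neg, norm_one, one_pow, one_mul]

theorem exists_haltsAfter (hb : b ≠ 0) {v : Vec n}
    (hv : (dominantSpace b).starProjection v ≠ 0) {ε : ℝ} (hε : 0 < ε) :
    ∃ t, HaltsAfter b v ε t := by
  classical
  have h : ∃ t, loopGap b v t ≤ ε := ((tendsto_loopGap hb hv).eventually_le_const hε).exists
  exact ⟨Nat.find h, fun k hk => not_le.1 (Nat.find_min h hk), Nat.find_spec h⟩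

theorem HaltsAfter.unique {v : Vec n} {ε : ℝ} {t t' : ℕ} (h : HaltsAfter b v ε t)
    (h' : HaltsAfter b v ε t') : t = t' := by
  rcases lt_trichotomy t t' with hlt | rfl | hlt
  · exact absurd h.2 (not_le.2 (h'.1 t hlt))
  · rfl
  · exact absurd h'.2 (not_le.2 (h.1 t' hlt))

theorem gaPowerIteration_eq {v : Vec n} {ε : ℝ} {t : ℕ} (h : HaltsAfter b v ε t) :
    gaPowerIteration b v ε = some (outputAfter t b v) := by
  have hex : ∃ t, HaltsAfter b v ε t := ⟨t, h⟩
  rw [gaPowerIteration, dif_pos hex, hex.choose_spec.unique h]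

/-- A vanishing gap means that the iterates have become stationary. -/
theorem loopState_eq_limitVec_of_loopGap_eq_zero (hb : b ≠ 0) {v : Vec n}
    (hv : (dominantSpace b).starProjection v ≠ 0) {t : ℕ} (h : loopGap b v t = 0) :
    (-1 : ℝ) ^ t • (loopState b v t).1 = limitVec b v := by
  cases t with
  | zero =>
    -- Initially `v_prev = v`, so the gap is `‖2v‖`, nonzero since `v` has a nonzero projection.
    rw [loopGap, loopState_zero, norm_eq_zero, ← two_smul ℝ, smul_eq_zero] at h
    rcases h with h | h
    · norm_num at h
    · exact absurd (by rw [show v = 0 from h, map_zero]) hv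
  | succ t =>
    -- `powerStep` is odd, so one exact sign flip repeats forever; the signed sequence is then
    -- constant and equals its limit.
    have hstep : ∀ k, (loopState b v (t + k + 1)).1 = -(loopState b v (t + k)).1 := by
      intro k
      induction k with
      | zero =>
        rw [loopGap, norm_eq_zero, loopState_succ b v t, add_eq_zero_iff_eq_neg] at h
        rw [add_zero, loopState_succ]
        exact h
      | succ k ih =>
        have h1 := congrArg (powerStep b) ih
        rw [powerStep_neg] at h1
        rw [loopState_succ b v (t + (k + 1)), ← add_assoc, h1, loopState_succ b v (t + k)]
    have hconst : ∀ k, (-1 : ℝ) ^ (k + (t + 1)) • (loopState b v (k + (t + 1))).1 =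
        (-1 : ℝ) ^ (t + 1) • (loopState b v (t + 1)).1 := by
      intro k
      induction k with
      | zero => rw [zero_add]
      | succ k ih =>
        have h1 := hstep (k + 1)
        rw [show t + (k + 1) + 1 = k + 1 + (t + 1) by ring,
          show t + (k + 1) = k + (t + 1) by ring] at h1
        rw [← ih, h1, show k + 1 + (t + 1) = k + (t + 1) + 1 by ring, pow_succ, mul_neg_one,
          neg_smul, smul_neg, neg_neg]
    have hlim := (tendsto_add_atTop_iff_nat (t + 1)).2 (tendsto_loopState hb hv)
    simp only [hconst] at hlim
    exact tendsto_nhds_unique tendsto_const_nhds hlim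

/-- Small thresholds force the returned vector into any neighbourhood of the limit. -/
theorem exists_threshold (hb : b ≠ 0) {v : Vec n}
    (hv : (dominantSpace b).starProjection v ≠ 0) {P : Vec n → Prop}
    (hP : ∀ᶠ x in 𝓝 (limitVec b v), P x) :
    ∃ ε₀ : ℝ, 0 < ε₀ ∧ ∀ ε : ℝ, 0 < ε → ε ≤ ε₀ →
      ∃ t : ℕ, HaltsAfter b v ε (t + 1) ∧
        P ((-1 : ℝ) ^ (t + 1) • (loopState b v (t + 1)).1) := by
  obtain ⟨T, hT⟩ := eventually_atTop.1 ((tendsto_loopState hb hv).eventually hP)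
  -- Choose `ε₀` below every nonzero gap up to pass `T`. Stopping before `T + 1` passes then
  -- requires a zero gap, hence an exact limit.
  have hfin : ∀ᶠ ε in 𝓝[>] (0 : ℝ), ∀ t ∈ Finset.range (T + 1), loopGap b v t ≠ 0 →
      ε < loopGap b v t := by
    rw [Filter.eventually_all_finset]
    intro t _
    by_cases h : loopGap b v t = 0
    · simp [h]
    · have hpos : 0 < loopGap b v t := lt_of_le_of_ne (norm_nonneg _) (Ne.symm h)
      filter_upwards [mem_nhdsWithin_of_mem_nhds (Iio_mem_nhds hpos)] with ε hε _ using hε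
  obtain ⟨ε₀, hε₀, hε₀'⟩ := (hfin.and self_mem_nhdsWithin).exists
  refine ⟨ε₀, hε₀', fun ε hε hle => ?_⟩
  obtain ⟨t, ht⟩ := exists_haltsAfter hb hv hε
  have hsmall : t < T + 1 → loopGap b v t = 0 := by
    intro hlt
    by_contra hne
    have h1 := hε₀ t (Finset.mem_range.2 hlt) hne
    have h2 := ht.2
    linarith
  -- At least one pass is made, so the returned vector is normalized.
  cases t with
  | zero =>
    have h := hsmall (Nat.succ_pos _)
    rw [loopGap, loopState_zero, norm_eq_zero, ← two_smul ℝ, smul_eq_zero] at h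
    rcases h with h | h
    · norm_num at h
    · exact absurd (by rw [show v = 0 from h, map_zero]) hv
  | succ t =>
    refine ⟨t, ht, ?_⟩
    by_cases hlt : t + 1 < T + 1
    · rw [loopState_eq_limitVec_of_loopGap_eq_zero hb hv (hsmall hlt)]
      exact hP.self_of_nhds
    · exact hT _ (by omega)

end PowerIteration

/-! ### Best simple and best rank two approximation -/

section Approximation

variable {n : ℕ} {b : Bivector n}

theorem wedge_smul_left (c : ℝ) (u v : Vec n) : wedge (c • u) v = c • wedge u v :=
  LinearMap.map_smul₂ wedgeₗ c u v

theorem wedge_smul_right (c : ℝ) (u v : Vec n) : wedge u (c • v) = c • wedge u v :=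
  map_smul (wedgeₗ u) c v

theorem wedge_add_left (u u' v : Vec n) : wedge (u + u') v = wedge u v + wedge u' v :=
  LinearMap.map_add₂ wedgeₗ u u' v

theorem wedge_self (v : Vec n) : wedge v v = 0 :=
  Subtype.ext (sub_eq_zero.2 (CliffordAlgebra.ι_sq_scalar _ v))

theorem wedge_zero_left (v : Vec n) : wedge 0 v = 0 := LinearMap.map_zero₂ wedgeₗ v

theorem wedge_zero_right (u : Vec n) : wedge u 0 = 0 := map_zero (wedgeₗ u)

theorem norm_sq_wedge {u w : Vec n} (hu : ‖u‖ = 1) (hw : ‖w‖ = 1) (huw : ⟪u, w⟫_ℝ = 0) :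
    ‖wedge u w‖ ^ 2 = 1 := by
  rw [← real_inner_self_eq_norm_sq, inner_wedge_wedge, huw, real_inner_self_eq_norm_sq,
    real_inner_self_eq_norm_sq, hu, hw]
  norm_num

/-- A simple bivector is zero or a multiple of the outer product of two orthonormal vectors. -/
theorem IsSimple.eq_zero_or {s : Bivector n} (hs : IsSimple s) :
    s = 0 ∨ ∃ (a : ℝ) (u w : Vec n), ‖u‖ = 1 ∧ ‖w‖ = 1 ∧ ⟪u, w⟫_ℝ = 0 ∧ s = a • wedge u w := by
  obtain ⟨x, y, rfl⟩ := hs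
  by_cases hy : y = 0
  · exact Or.inl (by rw [hy, wedge_zero_right])
  have hy' : ‖y‖ ≠ 0 := norm_ne_zero_iff.2 hy
  -- One Gram–Schmidt step: subtracting a multiple of `y` from `x` leaves `x ∧ y` unchanged.
  set z : Vec n := x + (-(⟪x, y⟫_ℝ / ‖y‖ ^ 2)) • y with hz
  have hxz : wedge x y = wedge z y := by
    rw [hz, wedge_add_left, wedge_smul_left, wedge_self, smul_zero, add_zero]
  have hzy : ⟪z, y⟫_ℝ = 0 := by
    rw [hz, inner_add_left, real_inner_smul_left, real_inner_self_eq_norm_sq]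
    field_simp
    ring
  by_cases hz0 : z = 0
  · exact Or.inl (by rw [hxz, hz0, wedge_zero_left])
  have hz' : ‖z‖ ≠ 0 := norm_ne_zero_iff.2 hz0
  refine Or.inr ⟨‖z‖ * ‖y‖, ‖z‖⁻¹ • z, ‖y‖⁻¹ • y, ?_, ?_, ?_, ?_⟩
  · rw [norm_smul, norm_inv, norm_norm, inv_mul_cancel₀ hz']
  · rw [norm_smul, norm_inv, norm_norm, inv_mul_cancel₀ hy']
  · rw [real_inner_smul_left, real_inner_smul_right, hzy, mul_zero, mul_zero]
  · rw [hxz, wedge_smul_left, wedge_smul_right, smul_smul, smul_smul,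
      show ‖z‖ * ‖y‖ * ‖z‖⁻¹ * ‖y‖⁻¹ = 1 by field_simp, one_smul]

theorem norm_sub_smul_wedge_sq (b : Bivector n) {u w : Vec n} (hu : ‖u‖ = 1) (hw : ‖w‖ = 1)
    (huw : ⟪u, w⟫_ℝ = 0) (a : ℝ) :
    ‖b - a • wedge u w‖ ^ 2 = ‖b‖ ^ 2 - 2 * a * ⟪u, contract b w⟫_ℝ + a ^ 2 := by
  rw [norm_sub_sq_real, inner_smul_right, real_inner_comm, inner_wedge_left, norm_smul, mul_pow,
    norm_sq_wedge hu hw huw, Real.norm_eq_abs, sq_abs]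
  ring

theorem norm_contract_le_of_norm_eq_one {w : Vec n} (hw : ‖w‖ = 1) :
    ‖contract b w‖ ≤ topSingularValue b := by
  simpa [hw] using norm_contract_le b w

theorem inner_contract_sq_le {u w : Vec n} (hu : ‖u‖ = 1) (hw : ‖w‖ = 1) :
    ⟪u, contract b w⟫_ℝ ^ 2 ≤ topSingularValue b ^ 2 := by
  have h1 := abs_real_inner_le_norm u (contract b w)
  rw [hu, one_mul] at h1
  rw [← sq_abs]
  exact pow_le_pow_left₀ (abs_nonneg _) (h1.trans (norm_contract_le_of_norm_eq_one hw)) 2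

/-- Completing the square in `a` leaves `‖b‖² - ⟪u, A w⟫²`, and Cauchy–Schwarz bounds the subtracted
term by `σ₁²`. -/
theorem IsSimple.norm_sq_sub_le {s : Bivector n} (hs : IsSimple s) :
    ‖b‖ ^ 2 - topSingularValue b ^ 2 ≤ ‖b - s‖ ^ 2 := by
  rcases hs.eq_zero_or with rfl | ⟨a, u, w, hu, hw, huw, rfl⟩
  · rw [sub_zero]
    linarith [sq_nonneg (topSingularValue b)]
  · rw [norm_sub_smul_wedge_sq b hu hw huw]
    linarith [inner_contract_sq_le (b := b) hu hw, sq_nonneg (a - ⟪u, contract b w⟫_ℝ)]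

theorem norm_sub_dominant_sq {u v : Vec n} (hu : ‖u‖ = 1) (hv : ‖v‖ = 1)
    (huv : ⟪u, v⟫_ℝ = 0) (hbv : contract b v = topSingularValue b • u) :
    ‖b - topSingularValue b • wedge u v‖ ^ 2 = ‖b‖ ^ 2 - topSingularValue b ^ 2 := by
  rw [norm_sub_smul_wedge_sq b hu hv huv, hbv, real_inner_smul_right, real_inner_self_eq_norm_sq,
    hu]
  ring

theorem isSimpleProjection_dominant {u v : Vec n} (hu : ‖u‖ = 1) (hv : ‖v‖ = 1)
    (huv : ⟪u, v⟫_ℝ = 0) (hbv : contract b v = topSingularValue b • u) :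
    IsSimpleProjection b (topSingularValue b • wedge u v) := by
  refine ⟨⟨topSingularValue b • u, v, (wedge_smul_left _ _ _).symm⟩, fun s' hs' => ?_⟩
  refine (sq_le_sq₀ (norm_nonneg _) (norm_nonneg _)).1 ?_
  rw [norm_sub_dominant_sq hu hv huv hbv]
  exact hs'.norm_sq_sub_le

/-- If the dominant eigenspace is a plane, then the simple projection is unique. -/
theorem eq_dominant_of_isSimpleProjection {u v : Vec n} (hu : ‖u‖ = 1) (hv : ‖v‖ = 1)
    (huv : ⟪u, v⟫_ℝ = 0) (hbv : contract b v = topSingularValue b • u)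
    (hb : b ≠ 0) (hvE : v ∈ dominantSpace b)
    (hdim : Module.finrank ℝ (dominantSpace b) = 2) {s : Bivector n}
    (hs : IsSimpleProjection b s) : s = topSingularValue b • wedge u v := by
  have hσ := topSingularValue_pos hb
  have hle : ‖b - s‖ ^ 2 ≤ ‖b‖ ^ 2 - topSingularValue b ^ 2 := by
    rw [← norm_sub_dominant_sq hu hv huv hbv]
    exact pow_le_pow_left₀ (norm_nonneg _)
      (hs.2 _ (isSimpleProjection_dominant hu hv huv hbv).1) 2
  rcases hs.1.eq_zero_or with rfl | ⟨a, x, y, hx, hy, hxy, rfl⟩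
  · rw [sub_zero] at hle
    linarith [pow_pos hσ 2]
  rw [norm_sub_smul_wedge_sq b hx hy hxy] at hle
  have hc := inner_contract_sq_le (b := b) hx hy
  -- A minimizer attains equality in the completed square and in the Cauchy–Schwarz bound.
  have hac : a = ⟪x, contract b y⟫_ℝ := by
    have : (a - ⟪x, contract b y⟫_ℝ) ^ 2 = 0 :=
      le_antisymm (by linarith) (sq_nonneg _)
    exact sub_eq_zero.1 (pow_eq_zero_iff two_ne_zero |>.1 this)
  have ha : a ^ 2 = topSingularValue b ^ 2 := by
    rw [← hac] at hle hc
    nlinarith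
  -- Equality in both bounds makes `A q` parallel to `p` and of maximal length, so `q` lies in `E`.
  -- It is used for `(x, y)` and, by skewness, for `(y, x)`.
  have key : ∀ p q : Vec n, ‖p‖ = 1 → ‖q‖ = 1 → ⟪p, contract b q⟫_ℝ ^ 2 = topSingularValue b ^ 2 →
      q ∈ dominantSpace b ∧ contract b q = ⟪p, contract b q⟫_ℝ • p := by
    intro p q hp hq h
    have h1 : ‖contract b q‖ ^ 2 ≤ topSingularValue b ^ 2 :=
      pow_le_pow_left₀ (norm_nonneg _) (norm_contract_le_of_norm_eq_one hq) 2
    have h2 : ‖contract b q - ⟪p, contract b q⟫_ℝ • p‖ ^ 2 =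
        ‖contract b q‖ ^ 2 - ⟪p, contract b q⟫_ℝ ^ 2 := by
      rw [norm_sub_sq_real, real_inner_smul_right, real_inner_comm, norm_smul, hp,
        Real.norm_eq_abs, mul_one, sq_abs]
      ring
    have h3 : ‖contract b q - ⟪p, contract b q⟫_ℝ • p‖ ^ 2 = 0 :=
      le_antisymm (by rw [h2]; linarith) (sq_nonneg _)
    refine ⟨mem_dominantSpace_of_norm_contract b ?_, ?_⟩
    · rw [hq, mul_one]
      refine (pow_left_inj₀ (norm_nonneg _) hσ.le two_ne_zero).1 ?_
      rw [← h]
      linarith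
    · exact sub_eq_zero.1 (norm_eq_zero.1 (pow_eq_zero_iff two_ne_zero |>.1 h3))
  obtain ⟨hyE, hby⟩ := key x y hx hy (by rw [← hac, ha])
  have hswap : ⟪y, contract b x⟫_ℝ = -a := by
    rw [hac, ← contract_skew, real_inner_comm]
  obtain ⟨hxE, hbx⟩ := key y x hy hx (by rw [hswap, neg_sq, ha])
  rw [← hac] at hby
  rw [hswap] at hbx
  have hon : Orthonormal ℝ ![x, y] := by
    refine ⟨fun i => ?_, fun i j hij => ?_⟩
    · fin_cases i <;> simp [hx, hy]
    · have hyx : ⟪y, x⟫_ℝ = 0 := by rw [real_inner_comm, hxy]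
      fin_cases i <;> fin_cases j
      · exact absurd rfl hij
      · exact hxy
      · exact hyx
      · exact absurd rfl hij
  have hspan : Submodule.span ℝ (Set.range ![x, y]) = dominantSpace b := by
    refine Submodule.eq_of_le_of_finrank_eq ?_ ?_
    · rw [Submodule.span_le]
      rintro _ ⟨i, rfl⟩
      fin_cases i
      · exact hxE
      · exact hyE
    · rw [finrank_span_eq_card hon.linearIndependent, hdim, Fintype.card_fin]
  -- `b` and `a (x ∧ y)` contract identically on the plane `E`, spanned by `x` and `y`; this yields
  -- their common pairing `σ₁` with `u ∧ v`.
  have hagree : contract (a • wedge x y) v = contract b v := by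
    rw [← hspan] at hvE
    refine LinearMap.eqOn_span (f := contract (a • wedge x y)) (g := contract b) ?_ hvE
    have hs : contract (a • wedge x y) = a • contract (wedge x y) := map_smul contractₗ _ _
    rintro _ ⟨i, rfl⟩
    have hyx : ⟪y, x⟫_ℝ = 0 := by rw [real_inner_comm, hxy]
    fin_cases i <;>
      simp [hs, contract_wedge, hxy, hyx, hx, hy, hbx, hby]
  have hinner : ⟪wedge u v, a • wedge x y⟫_ℝ = topSingularValue b := by
    rw [inner_wedge_left, hagree, hbv, real_inner_smul_right, real_inner_self_eq_norm_sq, hu]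
    ring
  -- The squared distance is `a² - 2σ₁·σ₁ + σ₁²`, which vanishes as `a² = σ₁²`.
  rw [← sub_eq_zero, ← norm_eq_zero, ← sq_eq_zero_iff, norm_sub_sq_real, real_inner_smul_right,
    real_inner_comm, hinner, norm_smul, norm_smul, mul_pow, mul_pow, norm_sq_wedge hx hy hxy,
    norm_sq_wedge hu hv huv, Real.norm_eq_abs, Real.norm_eq_abs, sq_abs, sq_abs, ha]
  ring

theorem rank_skewMatrix_wedge_le (u v : Vec n) : (skewMatrix (wedge u v)).rank ≤ 2 := by
  have h : LinearMap.range (skewMatrix (wedge u v)).mulVecLin ≤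
      Submodule.span ℝ ({u.ofLp, v.ofLp} : Set (Fin n → ℝ)) := by
    rintro _ ⟨x, rfl⟩
    have h1 := contract_eq_mulVec (wedge u v) (WithLp.toLp 2 x)
    rw [contract_wedge] at h1
    have h2 : _ = skewMatrix (wedge u v) *ᵥ x := congrArg WithLp.ofLp h1
    rw [Matrix.mulVecLin_apply, ← h2]
    simp only [WithLp.ofLp_sub, WithLp.ofLp_smul]
    exact Submodule.sub_mem _ (Submodule.smul_mem _ _ (Submodule.subset_span (by simp)))
      (Submodule.smul_mem _ _ (Submodule.subset_span (by simp)))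
  refine (Submodule.finrank_mono h).trans ((finrank_span_le_card _).trans ?_)
  rw [Set.toFinset_insert, Set.toFinset_singleton]
  exact Finset.card_le_two

/-- The Eckart–Young lower bound for approximations of rank at most two. -/
theorem frobenius_sub_ge (b : Bivector n) {M : Matrix (Fin n) (Fin n) ℝ} (hM : M.rank ≤ 2) :
    2 * ‖b‖ ^ 2 - 2 * topSingularValue b ^ 2 ≤ ∑ i, ∑ j, (skewMatrix b i j - M i j) ^ 2 := by
  let L : (Fin n → ℝ) ≃ₗ[ℝ] Vec n := (WithLp.linearEquiv 2 ℝ (Fin n → ℝ)).symm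
  let R : Submodule ℝ (Vec n) := (LinearMap.range M.mulVecLin).map (L : (Fin n → ℝ) →ₗ[ℝ] Vec n)
  have hR : Module.finrank ℝ R ≤ 2 := by
    have : Module.finrank ℝ R = M.rank := LinearEquiv.finrank_map_eq L _
    rwa [this]
  let col : Fin n → Vec n := fun j => WithLp.toLp 2 fun i => M i j
  have hcol : ∀ j, col j ∈ R := by
    intro j
    refine ⟨M.mulVecLin (Pi.single j 1), ⟨_, rfl⟩, ?_⟩
    rw [Matrix.mulVecLin_apply, Matrix.mulVec_single_one]
    rfl
  have hcolnorm : ∀ j, ∑ i, (skewMatrix b i j - M i j) ^ 2 =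
      ‖contract b (stdVec j) - col j‖ ^ 2 := by
    intro j
    rw [EuclideanSpace.norm_sq_eq]
    exact Finset.sum_congr rfl fun i _ => by
      rw [skewMatrix_apply, Real.norm_eq_abs, sq_abs]
      rfl
  have hbnorm : 2 * ‖b‖ ^ 2 = ∑ j, ‖contract b (stdVec j)‖ ^ 2 := by
    rw [norm_sq_bivector, ← mul_assoc, mul_inv_cancel₀ two_ne_zero, one_mul, Finset.sum_comm]
    refine Finset.sum_congr rfl fun j _ => ?_
    rw [EuclideanSpace.norm_sq_eq]
    exact Finset.sum_congr rfl fun i _ => by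
      rw [skewMatrix_apply, Real.norm_eq_abs, sq_abs]
  -- Column by column, nothing in the column space `R` of `M` is closer than the orthogonal
  -- projection onto `R`.
  have hdist : ∀ j, ‖contract b (stdVec j)‖ ^ 2 - ‖R.starProjection (contract b (stdVec j))‖ ^ 2 ≤
      ‖contract b (stdVec j) - col j‖ ^ 2 := by
    intro j
    set x := contract b (stdVec j)
    have h1 : ⟪x - R.starProjection x, R.starProjection x - col j⟫_ℝ = 0 :=
      Submodule.starProjection_inner_eq_zero x _
        (R.sub_mem (Submodule.starProjection_apply_mem _ x) (hcol j))
    have h2 : ⟪x - R.starProjection x, R.starProjection x⟫_ℝ = 0 :=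
      Submodule.starProjection_inner_eq_zero x _ (Submodule.starProjection_apply_mem _ x)
    have h3 := norm_add_sq_real (x - R.starProjection x) (R.starProjection x - col j)
    have h4 := norm_add_sq_real (x - R.starProjection x) (R.starProjection x)
    rw [h1, sub_add_sub_cancel] at h3
    rw [h2, sub_add_cancel] at h4
    rw [h3, h4]
    linarith [sq_nonneg ‖R.starProjection x - col j‖]
  let r := stdOrthonormalBasis ℝ R
  have hproj : ∀ x : Vec n, ‖R.starProjection x‖ ^ 2 = ∑ k, ⟪(r k : Vec n), x⟫_ℝ ^ 2 := by
    intro x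
    have h1 : ‖R.starProjection x‖ = ‖R.orthogonalProjectionOnto x‖ := rfl
    rw [h1, ← r.sum_sq_norm_inner_right]
    refine Finset.sum_congr rfl fun k _ => ?_
    rw [Submodule.inner_orthogonalProjectionOnto_eq_of_mem_left, Real.norm_eq_abs, sq_abs]
  have hsum : ∑ j, ‖R.starProjection (contract b (stdVec j))‖ ^ 2 ≤ 2 * topSingularValue b ^ 2 := by
    simp only [hproj]
    rw [Finset.sum_comm]
    have hk : ∀ k, ∑ j, ⟪(r k : Vec n), contract b (stdVec j)⟫_ℝ ^ 2 ≤
        topSingularValue b ^ 2 := by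
      intro k
      -- Skewness moves `A` onto the basis vector of `R`, so each of the at most two basis vectors
      -- contributes at most `σ₁²`.
      have h1 : ‖contract b (r k)‖ ^ 2 = ∑ j, ⟪(r k : Vec n), contract b (stdVec j)⟫_ℝ ^ 2 := by
        rw [EuclideanSpace.norm_sq_eq]
        refine Finset.sum_congr rfl fun j _ => ?_
        rw [← neg_sq ⟪(r k : Vec n), _⟫_ℝ, ← contract_skew]
        simp [stdVec, EuclideanSpace.inner_single_right]
      rw [← h1]
      refine pow_le_pow_left₀ (norm_nonneg _) (norm_contract_le_of_norm_eq_one ?_) 2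
      exact r.orthonormal.1 k
    refine (Finset.sum_le_sum fun k _ => hk k).trans ?_
    rw [Finset.sum_const, Finset.card_univ, Fintype.card_fin, nsmul_eq_mul]
    exact mul_le_mul_of_nonneg_right (by exact_mod_cast hR) (sq_nonneg _)
  rw [Finset.sum_comm, Finset.sum_congr rfl fun j _ => hcolnorm j]
  have := Finset.sum_le_sum fun j (_ : j ∈ Finset.univ) => hdist j
  rw [Finset.sum_sub_distrib, ← hbnorm] at this
  linarith

theorem isBestRankTwo_dominant {u v : Vec n} (hu : ‖u‖ = 1) (hv : ‖v‖ = 1) (huv : ⟪u, v⟫_ℝ = 0)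
    (hbv : contract b v = topSingularValue b • u) :
    IsBestRankTwo b (topSingularValue b • wedge u v) := by
  refine ⟨?_, fun M hM => ?_⟩
  · rw [← wedge_smul_left]
    exact rank_skewMatrix_wedge_le _ _
  · refine le_trans (le_of_eq ?_) (frobenius_sub_ge b hM)
    -- The squared Frobenius norm is twice the squared bivector norm.
    have h := norm_sq_bivector (b - topSingularValue b • wedge u v)
    rw [norm_sub_dominant_sq hu hv huv hbv] at h
    have h2 : ∀ i j, skewMatrix (b - topSingularValue b • wedge u v) i j =
        skewMatrix b i j - skewMatrix (topSingularValue b • wedge u v) i j :=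
      fun i j => by simp only [skewMatrix, Matrix.of_apply, inner_sub_right]
    simp only [h2] at h
    linarith

end Approximation

/-! ### Smooth dependence on the input -/

section Smoothness

variable {n : ℕ}

theorem contDiffAt_bilinear {D E F G : Type*} [NormedAddCommGroup D] [NormedSpace ℝ D]
    [NormedAddCommGroup E] [NormedSpace ℝ E] [FiniteDimensional ℝ E]
    [NormedAddCommGroup F] [NormedSpace ℝ F] [FiniteDimensional ℝ F]
    [NormedAddCommGroup G] [NormedSpace ℝ G] (B : E →ₗ[ℝ] F →ₗ[ℝ] G) {f : D → E} {g : D → F}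
    {x : D} (hf : ContDiffAt ℝ ∞ f x) (hg : ContDiffAt ℝ ∞ g x) :
    ContDiffAt ℝ ∞ (fun p => B (f p) (g p)) x := by
  let B' : E →ₗ[ℝ] F →L[ℝ] G := (LinearMap.toContinuousLinearMap : (F →ₗ[ℝ] G) ≃ₗ[ℝ] _) ∘ₗ B
  have h : ContDiffAt ℝ ∞ (fun p => LinearMap.toContinuousLinearMap B' (f p) (g p)) x :=
    ((LinearMap.toContinuousLinearMap B').contDiff.contDiffAt.comp x hf).clm_apply hg
  exact h

theorem contDiffAt_contract {D : Type*} [NormedAddCommGroup D] [NormedSpace ℝ D]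
    {f : D → Bivector n} {g : D → Vec n} {x : D} (hf : ContDiffAt ℝ ∞ f x)
    (hg : ContDiffAt ℝ ∞ g x) : ContDiffAt ℝ ∞ (fun p => contract (f p) (g p)) x :=
  contDiffAt_bilinear contractₗ hf hg

theorem contDiffAt_wedge {D : Type*} [NormedAddCommGroup D] [NormedSpace ℝ D]
    {f g : D → Vec n} {x : D} (hf : ContDiffAt ℝ ∞ f x)
    (hg : ContDiffAt ℝ ∞ g x) : ContDiffAt ℝ ∞ (fun p => wedge (f p) (g p)) x :=
  contDiffAt_bilinear wedgeₗ hf hg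

variable {b : Bivector n} {v : Vec n}

theorem contDiffAt_loopState (h0 : ∀ t, contract b (contract b (loopState b v t).1) ≠ 0) (t : ℕ) :
    ContDiffAt ℝ ∞ (fun p : Bivector n × Vec n => loopState p.1 p.2 t) (b, v) := by
  induction t with
  | zero =>
    simp only [loopState_zero]
    exact contDiffAt_snd.prodMk contDiffAt_snd
  | succ t ih =>
    simp only [loopState_succ]
    refine ContDiffAt.prodMk ?_ ih.fst
    have h1 : ContDiffAt ℝ ∞ (fun p : Bivector n × Vec n =>
        contract p.1 (loopState p.1 p.2 t).1) (b, v) :=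
      contDiffAt_contract contDiffAt_fst ih.fst
    have h2 : ContDiffAt ℝ ∞ (fun p : Bivector n × Vec n =>
        contract p.1 (contract p.1 (loopState p.1 p.2 t).1)) (b, v) :=
      contDiffAt_contract contDiffAt_fst h1
    exact ((h2.norm ℝ (h0 t)).inv (norm_ne_zero_iff.2 (h0 t))).smul h2

theorem contDiffAt_outputAfter (h0 : ∀ t, contract b (contract b (loopState b v t).1) ≠ 0)
    (t : ℕ) : ContDiffAt ℝ ∞ (fun p : Bivector n × Vec n => outputAfter t p.1 p.2) (b, v) := by
  have h := (contDiffAt_loopState h0 t).fst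
  have h1 : ContDiffAt ℝ ∞ (fun p : Bivector n × Vec n =>
      contract p.1 (loopState p.1 p.2 t).1) (b, v) :=
    contDiffAt_contract contDiffAt_fst h
  exact (contDiffAt_wedge h1 h).prodMk h

theorem continuousAt_loopGap (h0 : ∀ t, contract b (contract b (loopState b v t).1) ≠ 0) (t : ℕ) :
    ContinuousAt (fun p : Bivector n × Vec n => loopGap p.1 p.2 t) (b, v) := by
  have h := (contDiffAt_loopState h0 t).continuousAt
  exact (h.fst.add h.snd).norm

/-- The earlier tests are finitely many strict inequalities between continuous functions, and `hne`
makes the last one strict too; all persist nearby. -/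
theorem eventually_gaPowerIteration_eq
    (h0 : ∀ t, contract b (contract b (loopState b v t).1) ≠ 0) {ε : ℝ} {t : ℕ}
    (ht : HaltsAfter b v ε t) (hne : loopGap b v t ≠ ε) :
    ∀ᶠ p in 𝓝 (b, v), gaPowerIteration p.1 p.2 ε = some (outputAfter t p.1 p.2) := by
  have h1 : ∀ᶠ p : Bivector n × Vec n in 𝓝 (b, v), ∀ k ∈ Finset.range t,
      ε < loopGap p.1 p.2 k := by
    rw [Filter.eventually_all_finset]
    intro k hk
    exact (continuousAt_loopGap h0 k).eventually_const_lt (ht.1 k (Finset.mem_range.1 hk))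
  have h2 := (continuousAt_loopGap h0 t).eventually_lt_const (lt_of_le_of_ne ht.2 hne)
  filter_upwards [h1, h2] with p hp1 hp2
  exact gaPowerIteration_eq ⟨fun k hk => hp1 k (Finset.mem_range.2 hk), hp2.le⟩

end Smoothness

/-! ### Accuracy of the returned pair -/

section Output

variable {n : ℕ} {b : Bivector n} {v : Vec n}

/-- For small thresholds the output is close to the dominant component of `b`. -/
theorem exists_threshold_output (hb : b ≠ 0) (hv : (dominantSpace b).starProjection v ≠ 0)
    {u₁ : Vec n} (hu₁ : ‖u₁‖ = 1) (hbv : contract b (limitVec b v) = topSingularValue b • u₁)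
    {δ : ℝ} (hδ : 0 < δ) :
    ∃ ε₀ : ℝ, 0 < ε₀ ∧ ∀ ε : ℝ, 0 < ε → ε ≤ ε₀ →
      ∃ (σ : ℝ) (u w : Vec n),
        gaPowerIteration b v ε = some (σ • wedge u w, w) ∧
        0 < σ ∧ ‖u‖ = 1 ∧ ‖w‖ = 1 ∧ ⟪u, w⟫_ℝ = 0 ∧ contract b w = σ • u ∧
        |σ - topSingularValue b| < δ ∧
        ‖σ • wedge u w - topSingularValue b • wedge u₁ (limitVec b v)‖ < δ ∧
        ((‖u - u₁‖ < δ ∧ ‖w - limitVec b v‖ < δ) ∨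
          (‖u + u₁‖ < δ ∧ ‖w + limitVec b v‖ < δ)) := by
  have hσ := topSingularValue_pos hb
  have hc : Continuous (contract b) := (contract b).continuous_of_finiteDimensional
  have hnorm : ‖contract b (limitVec b v)‖ = topSingularValue b := by
    rw [hbv, norm_smul, hu₁, mul_one, Real.norm_of_nonneg hσ.le]
  have hne : ‖contract b (limitVec b v)‖ ≠ 0 := hnorm ▸ hσ.ne'
  have hu : ‖contract b (limitVec b v)‖⁻¹ • contract b (limitVec b v) = u₁ := by
    rw [hnorm, hbv, smul_smul, inv_mul_cancel₀ hσ.ne', one_smul]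
  have e1 : ∀ᶠ x in 𝓝 (limitVec b v), |‖contract b x‖ - topSingularValue b| < δ := by
    have := hc.norm.tendsto (limitVec b v)
    rw [hnorm] at this
    exact (Metric.tendsto_nhds.1 this) δ hδ
  have e2 : ∀ᶠ x in 𝓝 (limitVec b v),
      ‖wedge (contract b x) x - topSingularValue b • wedge u₁ (limitVec b v)‖ < δ := by
    have h1 : ContDiffAt ℝ ∞ (fun x => wedge (contract b x) x) (limitVec b v) :=
      contDiffAt_wedge (contDiffAt_contract contDiffAt_const contDiffAt_id) contDiffAt_id
    have := h1.continuousAt.tendsto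
    rw [hbv, wedge_smul_left] at this
    simpa only [dist_eq_norm] using (Metric.tendsto_nhds.1 this) δ hδ
  have e3 : ∀ᶠ x in 𝓝 (limitVec b v), ‖‖contract b x‖⁻¹ • contract b x - u₁‖ < δ := by
    have h1 : Tendsto (fun x => ‖contract b x‖⁻¹ • contract b x) (𝓝 (limitVec b v)) (𝓝 u₁) := by
      have := (hc.norm.continuousAt.inv₀ hne).smul (hc.continuousAt (x := limitVec b v))
      rw [← hu]
      exact this.tendsto
    simpa only [dist_eq_norm] using (Metric.tendsto_nhds.1 h1) δ hδ
  have e4 : ∀ᶠ x in 𝓝 (limitVec b v), ‖x - limitVec b v‖ < δ := by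
    filter_upwards [Metric.ball_mem_nhds (limitVec b v) hδ] with x hx
    rwa [← dist_eq_norm]
  obtain ⟨ε₀, hε₀, h⟩ := exists_threshold hb hv (e1.and (e2.and (e3.and e4)))
  refine ⟨ε₀, hε₀, fun ε hε hle => ?_⟩
  obtain ⟨t, ht, h1, h2, h3, h4⟩ := h ε hε hle
  set w := (loopState b v (t + 1)).1 with hw
  have hcw : contract b w ≠ 0 := fun h0 =>
    contract_contract_loopState_ne_zero hb hv (t + 1) (by rw [← hw, h0, map_zero])
  have hcw' : ‖contract b w‖ ≠ 0 := norm_ne_zero_iff.2 hcw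
  have hσw : ‖contract b w‖ • ‖contract b w‖⁻¹ • contract b w = contract b w := by
    rw [smul_smul, mul_inv_cancel₀ hcw', one_smul]
  have hout : ‖contract b w‖ • wedge (‖contract b w‖⁻¹ • contract b w) w =
      wedge (contract b w) w := by rw [← wedge_smul_left, hσw]
  refine ⟨‖contract b w‖, ‖contract b w‖⁻¹ • contract b w, w, ?_, norm_pos_iff.2 hcw, ?_,
    norm_loopState_succ hb hv t, ?_, hσw.symm, ?_⟩
  · rw [gaPowerIteration_eq ht, hout, outputAfter]
  · rw [norm_smul, norm_inv, norm_norm, inv_mul_cancel₀ hcw']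
  · rw [real_inner_smul_left, inner_contract_self, mul_zero]
  · rw [hout]
    -- The estimates hold at `± w`. Flipping `w` flips `u` as well, so the bivector is unaffected
    -- and one sign serves both vectors.
    rcases neg_one_pow_eq_or ℝ (t + 1) with hs | hs
    · rw [hs, one_smul] at h1 h2 h3 h4
      exact ⟨h1, h2, Or.inl ⟨h3, h4⟩⟩
    · rw [hs, neg_one_smul] at h1 h2 h3 h4
      have hww : wedge (-contract b w) (-w) = wedge (contract b w) w := by
        rw [← neg_one_smul ℝ (contract b w), ← neg_one_smul ℝ w, wedge_smul_left, wedge_smul_right,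
          smul_smul]
        norm_num
      rw [map_neg, norm_neg] at h1 h3
      rw [map_neg, hww] at h2
      rw [smul_neg, ← neg_add', norm_neg] at h3
      rw [← neg_add', norm_neg] at h4
      exact ⟨h1, h2, Or.inr ⟨h3, h4⟩⟩

end Output

end GAPower

theorem mainTheorem3 (n : ℕ) (b : Bivector n) :
    -- right contraction by `b` is multiplication by the skew matrix `B` of `b`
    ((skewMatrix b)ᵀ = -skewMatrix b ∧
      b = ∑ i, ∑ j ∈ Finset.Ioi i, skewMatrix b i j • wedge (stdVec i) (stdVec j) ∧
      (∀ v : Vec n, contract b v = WithLp.toLp 2 (skewMatrix b *ᵥ v.ofLp)) ∧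
      (∀ v : Vec n, contract b (contract b v) = WithLp.toLp 2 ((skewMatrix b ^ 2) *ᵥ v.ofLp))) ∧
    (b ≠ 0 → ∀ v : Vec n, (dominantSpace b).starProjection v ≠ 0 →
      -- the normalization never divides by zero
      (∀ t, contract b (contract b (loopState b v t).1) ≠ 0) ∧
      -- the loop terminates for every positive threshold
      (∀ ε : ℝ, 0 < ε → ∃ t, HaltsAfter b v ε t) ∧
      (∃ u₁ ∈ dominantSpace b, ∃ v₁ ∈ dominantSpace b,
        ‖u₁‖ = 1 ∧ ‖v₁‖ = 1 ∧ ⟪u₁, v₁⟫_ℝ = 0 ∧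
        0 < topSingularValue b ∧
        contract b v₁ = topSingularValue b • u₁ ∧
        contract b u₁ = -(topSingularValue b • v₁) ∧
        -- `σ₁ (u₁ ∧ v₁)` is a best simple, and a best rank two, approximation of `b`
        IsSimpleProjection b (topSingularValue b • wedge u₁ v₁) ∧
        IsBestRankTwo b (topSingularValue b • wedge u₁ v₁) ∧
        (Module.finrank ℝ (dominantSpace b) = 2 → ∀ s : Bivector n,
          IsSimpleProjection b s → s = topSingularValue b • wedge u₁ v₁) ∧
        -- up to the alternating sign the iterates converge inside the dominant eigenspace
        Tendsto (fun t => (-1 : ℝ) ^ t • (loopState b v t).1) atTop (𝓝 v₁) ∧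
        -- the output is `σ (u ∧ w)`, as close to `σ₁ (u₁ ∧ v₁)` as desired
        (∀ δ : ℝ, 0 < δ → ∃ ε₀ : ℝ, 0 < ε₀ ∧ ∀ ε : ℝ, 0 < ε → ε ≤ ε₀ →
          ∃ (σ : ℝ) (u w : Vec n),
            gaPowerIteration b v ε = some (σ • wedge u w, w) ∧
            0 < σ ∧ ‖u‖ = 1 ∧ ‖w‖ = 1 ∧ ⟪u, w⟫_ℝ = 0 ∧ contract b w = σ • u ∧
            |σ - topSingularValue b| < δ ∧
            ‖σ • wedge u w - topSingularValue b • wedge u₁ v₁‖ < δ ∧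
            ((‖u - u₁‖ < δ ∧ ‖w - v₁‖ < δ) ∨ (‖u + u₁‖ < δ ∧ ‖w + v₁‖ < δ)))) ∧
      -- every finite computation is smooth at the input `(b, v)`
      (∀ t, ContDiffAt ℝ ∞ (fun p : Bivector n × Vec n => outputAfter t p.1 p.2) (b, v)) ∧
      -- unless the last test is an equality, the algorithm is such a computation near `(b, v)`
      (∀ (ε : ℝ) (t : ℕ), HaltsAfter b v ε t → loopGap b v t ≠ ε →
        ∀ᶠ p in 𝓝 (b, v), gaPowerIteration p.1 p.2 ε = some (outputAfter t p.1 p.2))) := by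
  refine ⟨⟨skewMatrix_transpose b, bivector_eq_sum b, contract_eq_mulVec b, fun v => ?_⟩, ?_⟩
  · rw [contract_eq_mulVec, contract_eq_mulVec b v, Matrix.mulVec_mulVec, pow_two]
  intro hb v hv
  have hσ := topSingularValue_pos hb
  have h0 := contract_contract_loopState_ne_zero hb hv
  refine ⟨h0, fun ε hε => exists_haltsAfter hb hv hε, ?_, contDiffAt_outputAfter h0,
    fun ε t ht hne => eventually_gaPowerIteration_eq h0 ht hne⟩
  set v₁ := limitVec b v with hv₁
  have hvE : v₁ ∈ dominantSpace b := limitVec_mem b v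
  have hvn : ‖v₁‖ = 1 := norm_limitVec hv
  have hsq : contract b (contract b v₁) = -(topSingularValue b ^ 2 • v₁) :=
    (mem_dominantSpace b).1 hvE
  -- On `E`, `‖A v₁‖² = -⟪A² v₁, v₁⟫ = σ₁²`, so dividing `A v₁` by `σ₁` gives a unit vector.
  have hn : ‖contract b v₁‖ = topSingularValue b := by
    refine (pow_left_inj₀ (norm_nonneg _) hσ.le two_ne_zero).1 ?_
    rw [norm_contract_sq, hsq, inner_neg_left, neg_neg, real_inner_smul_left,
      real_inner_self_eq_norm_sq, hvn, one_pow, mul_one]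
  set u₁ := (topSingularValue b)⁻¹ • contract b v₁ with hu₁
  have hbv : contract b v₁ = topSingularValue b • u₁ := by
    rw [hu₁, smul_smul, mul_inv_cancel₀ hσ.ne', one_smul]
  have hun : ‖u₁‖ = 1 := by
    rw [hu₁, norm_smul, hn, Real.norm_of_nonneg (inv_nonneg.2 hσ.le), inv_mul_cancel₀ hσ.ne']
  have huv : ⟪u₁, v₁⟫_ℝ = 0 := by
    rw [hu₁, real_inner_smul_left, inner_contract_self, mul_zero]
  refine ⟨u₁, Submodule.smul_mem _ _ (contract_mem_dominantSpace b hvE), v₁, hvE, hun, hvn, huv, hσ,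
    hbv, ?_, isSimpleProjection_dominant hun hvn huv hbv, isBestRankTwo_dominant hun hvn huv hbv,
    fun hdim s hs => eq_dominant_of_isSimpleProjection hun hvn huv hbv hb hvE hdim hs,
    tendsto_loopState hb hv, fun δ hδ => exists_threshold_output hb hv hun hbv hδ⟩
  rw [hu₁, map_smul, hsq, smul_neg, smul_smul, pow_two, inv_mul_cancel_left₀ hσ.ne']
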